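/- Let $L_{2\pi}$ be the space of complex-valued $2\pi$-periodic functions integrable over a period, with norm $\|g\|_L=\int_{-\pi}^{\pi}|g(x)|\,dx$. For $f\in L_{2\pi}$ write $\hat f(k)=\frac1{2\pi}\int_{-\pi}^{\pi}f(x)e^{-ikx}\,dx$, $S_n(f)(x)=\sum_{k=-n}^{n}\hat f(k)e^{ikx}$, and let $$E_n(f)_L=\inf_{c_k\in\mathbb C}\Big\|f-\sum_{k=-n}^{n}c_ke^{ikx}\Big\|_L .$$ A complex sequence $\{c_n\}_{n\ge 0}$ belongs to MVBVS (mean value bounded variation sequences) if there is $\theta\in[0,\pi/2)$ such that, for every $n\ge 0$, $c_n=0$ or $|\arg c_n|\le\theta$, and there are a real number $\lambda\ge 2$ and a constant $C>0$ such that $$\sum_{k=m}^{2m}|c_{k+1}-c_k|\le \frac{C}{m}\sum_{k=[\lambda^{-1}m]}^{[\lambda m]}|c_k|\qquad\text{for all } m=1,2,\dots$$ **Theorem 2.** Let $f\in L_{2\pi}$, and let $\{\psi_n\}_{n\ge0}$ be a (not necessarily strictly) decreasing sequence of real numbers tending to zero for which there are positive constants $C_1,C_2$ with $C_1\psi_n\le\psi_{2n}\le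 C_2\psi_n$ for all $n$. Suppose that both $\{\hat f(n)\}_{n\ge0}$ and $\{\hat f(-n)\}_{n\ge0}$ belong to MVBVS. Then $$\|f-S_n(f)\|_L=O(\psi_n)\qquad(n\to\infty)$$ if and only if both $$E_n(f)_L=O(\psi_n)\quad(n\to\infty)\qquad\text{and}\qquad \hat f(n)\log|n|=O(\psi_{|n|})\quad(|n|\to\infty,\ n\in\mathbb Z).$$ -/

import Mathlib

open Filter Asymptotics

/-- The space `L_{2π}`: complex-valued functions of period `2π`, integrable over a period. -/
def MemLTwoPi (f : ℝ → ℂ) : Prop :=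
  Function.Periodic f (2 * Real.pi) ∧
    IntervalIntegrable f MeasureTheory.volume (-Real.pi) Real.pi

/-- The norm `‖g‖_L = ∫_{-π}^{π} |g(x)| dx`. -/
noncomputable def normL (g : ℝ → ℂ) : ℝ :=
  ∫ x in (-Real.pi)..Real.pi, ‖g x‖

/-- The Fourier coefficient `f̂(n) = (1/2π) ∫_{-π}^{π} f(x) e^{-inx} dx`
(see `fhat_eq_integral`). -/
noncomputable def fhat (f : ℝ → ℂ) (n : ℤ) : ℂ :=
  fourierCoeffOn (neg_lt_self Real.pi_pos) f n

/-- The trigonometric polynomial `∑_{k=-n}^{n} c_k e^{ikx}`. -/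
noncomputable def trigPoly (n : ℕ) (c : ℤ → ℂ) (x : ℝ) : ℂ :=
  ∑ k ∈ Finset.Icc (-(n : ℤ)) (n : ℤ), c k * Complex.exp (Complex.I * (k : ℂ) * (x : ℂ))

/-- The symmetric partial sum `S_n(f, x)` of the Fourier series of `f`. -/
noncomputable def partialSum (f : ℝ → ℂ) (n : ℕ) (x : ℝ) : ℂ :=
  trigPoly n (fhat f) x

/-- The best approximation `E_n(f)_L` of `f` in the `L¹` norm by trigonometric polynomials of
degree `n`. -/
noncomputable def bestApprox (f : ℝ → ℂ) (n : ℕ) : ℝ :=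
  ⨅ c : ℤ → ℂ, normL (fun x => f x - trigPoly n c x)

/-- Mean value bounded variation sequences, in the complex sense: all terms lie in a sector
`K(θ) = {z : |arg z| ≤ θ}` with `θ ∈ [0, π/2)` (with `0 ∈ K(θ)`, as `Complex.arg 0 = 0`), and
`∑_{k=m}^{2m} |c_{k+1} - c_k| ≤ C (1/m) ∑_{k=[m/r]}^{[r m]} |c_k|` for all `m ≥ 1`, for some
real number `r ≥ 2` and some constant `C`. -/
def IsMVBVS (c : ℕ → ℂ) : Prop :=
  (∃ θ : ℝ, 0 ≤ θ ∧ θ < Real.pi / 2 ∧ ∀ n, |Complex.arg (c n)| ≤ θ) ∧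
  ∃ r : ℝ, 2 ≤ r ∧ ∃ C : ℝ, 0 < C ∧ ∀ m : ℕ, 1 ≤ m →
    ∑ k ∈ Finset.Icc m (2 * m), ‖c (k + 1) - c k‖ ≤
      C * (1 / (m : ℝ)) * ∑ k ∈ Finset.Icc ⌊r⁻¹ * (m : ℝ)⌋₊ ⌊r * (m : ℝ)⌋₊, ‖c k‖

theorem fhat_eq_integral (f : ℝ → ℂ) (n : ℤ) :
    fhat f n = (1 / (2 * (Real.pi : ℂ))) *
      ∫ x in (-Real.pi)..Real.pi, f x * Complex.exp (-(Complex.I * (n : ℂ) * (x : ℂ))) := by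
  have hpi : (Real.pi : ℂ) ≠ 0 := by exact_mod_cast Real.pi_ne_zero
  rw [fhat, fourierCoeffOn_eq_integral, Complex.real_smul]
  congr 1
  · push_cast; ring
  · refine intervalIntegral.integral_congr fun x _ => ?_
    simp only [fourier_coe_apply, smul_eq_mul]
    rw [mul_comm]
    congr 2
    push_cast
    field_simp
    ring

/-! The bridge between the two sides is the de la Vallée Poussin mean `valleePoussin f n`, written
V_n. It is bounded on L¹ uniformly in n and reproduces polynomials of degree n, so ‖f - V_n‖ ≤ 4
E_n(f).

Sufficiency: V_n - S_n(f) carries only frequencies n < |k| ≤ 2n, with linearly decreasing weights.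
Abel summation bounds its norm by log n times the size plus the variation of the coefficients on [n,
2n] (`normL_valleePoussin_sub_partialSum_le`). The logarithmic decay and the MVBV inequality make
both O(ψ_n / log n).

Necessity: E_n is at most the error of S_n. For the coefficients, shift the spectrum of f - S_N by
N, smooth with a Fejér mean and integrate against x on [0, 2π]. Since the coefficients lie in a
sector there is no cancellation, and ∑_{j≤M} |f̂(N+j)|/j ≲ ‖f - S_N‖ (`sum_norm_fhat_div_le`).
Adding over N turns the weights 1/j into a factor log M in front of a block sum of |f̂(k)|
(`log_mul_sum_le`), and MVBV controls a single coefficient by the mean over such a block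
(`norm_le_mean_of_mvbv`). Doubling of ψ absorbs the change of scale from M to n. -/

/-! ### Trigonometric polynomials, Fourier coefficients and the L¹ norm -/

theorem sum_Icc_neg_natCast {E : Type*} [AddCommMonoid E] (F : ℤ → E) (n : ℕ) :
    ∑ k ∈ Finset.Icc (-(n : ℤ)) (n : ℤ), F k =
      F 0 + ∑ k ∈ Finset.range n, (F ((k : ℤ) + 1) + F (-((k : ℤ) + 1))) := by
  induction n with
  | zero => simp
  | succ n ih =>
    have h : Finset.Icc (-((n + 1 : ℕ) : ℤ)) ((n + 1 : ℕ) : ℤ) =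
        insert ((n : ℤ) + 1) (insert (-((n : ℤ) + 1)) (Finset.Icc (-(n : ℤ)) (n : ℤ))) := by
      ext k
      simp only [Finset.mem_Icc, Finset.mem_insert]
      push_cast
      omega
    rw [h, Finset.sum_insert, Finset.sum_insert, ih, Finset.sum_range_succ]
    · abel
    · simp
    · simp only [Finset.mem_Icc, Finset.mem_insert]
      omega

theorem continuous_trigPoly (n : ℕ) (c : ℤ → ℂ) : Continuous (trigPoly n c) := by
  unfold trigPoly
  fun_prop

theorem exp_I_int_mul_add_two_pi (k : ℤ) (x : ℝ) :
    Complex.exp (Complex.I * (k : ℂ) * ((x + 2 * Real.pi : ℝ) : ℂ)) =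
      Complex.exp (Complex.I * (k : ℂ) * (x : ℂ)) := by
  rw [Complex.exp_eq_exp_iff_exists_int]
  exact ⟨k, by push_cast; ring⟩

theorem periodic_trigPoly (n : ℕ) (c : ℤ → ℂ) :
    Function.Periodic (trigPoly n c) (2 * Real.pi) := by
  intro x
  simp only [trigPoly, exp_I_int_mul_add_two_pi]

theorem integral_exp_I_int_mul (k : ℤ) :
    ∫ x in (-Real.pi)..Real.pi, Complex.exp (Complex.I * (k : ℂ) * (x : ℂ)) =
      if k = 0 then 2 * (Real.pi : ℂ) else 0 := by
  split_ifs with hk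
  · subst hk
    simp
    ring
  · have hc : Complex.I * (k : ℂ) ≠ 0 := by simp [hk]
    rw [integral_exp_mul_complex hc]
    have h := exp_I_int_mul_add_two_pi k (-Real.pi)
    have e : -Real.pi + 2 * Real.pi = Real.pi := by ring
    rw [e] at h
    rw [h]
    simp

theorem intervalIntegrable_mul_exp {g : ℝ → ℂ} {a b : ℝ}
    (hg : IntervalIntegrable g MeasureTheory.volume a b) (z : ℂ) :
    IntervalIntegrable (fun x : ℝ => g x * Complex.exp (z * (x : ℂ)))
      MeasureTheory.volume a b :=
  hg.mul_continuousOn (by fun_prop)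

theorem fhat_sub {f g : ℝ → ℂ}
    (hf : IntervalIntegrable f MeasureTheory.volume (-Real.pi) Real.pi)
    (hg : IntervalIntegrable g MeasureTheory.volume (-Real.pi) Real.pi) (n : ℤ) :
    fhat (fun x => f x - g x) n = fhat f n - fhat g n := by
  simp only [fhat_eq_integral, sub_mul]
  rw [intervalIntegral.integral_sub, mul_sub]
  · simpa only [neg_mul] using intervalIntegrable_mul_exp hf (-(Complex.I * n))
  · simpa only [neg_mul] using intervalIntegrable_mul_exp hg (-(Complex.I * n))

theorem fhat_trigPoly (n : ℕ) (c : ℤ → ℂ) (k : ℤ) :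
    fhat (trigPoly n c) k = if k ∈ Finset.Icc (-(n : ℤ)) (n : ℤ) then c k else 0 := by
  rw [fhat_eq_integral]
  have h : ∀ x : ℝ, trigPoly n c x * Complex.exp (-(Complex.I * (k : ℂ) * (x : ℂ))) =
      ∑ j ∈ Finset.Icc (-(n : ℤ)) (n : ℤ),
        c j * Complex.exp (Complex.I * ((j - k : ℤ) : ℂ) * (x : ℂ)) := by
    intro x
    rw [trigPoly, Finset.sum_mul]
    refine Finset.sum_congr rfl fun j _ => ?_
    rw [mul_assoc, ← Complex.exp_add]
    congr 2
    push_cast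
    ring
  simp only [h]
  rw [intervalIntegral.integral_finsetSum
    (fun j _ => Continuous.intervalIntegrable (by fun_prop) _ _)]
  simp only [intervalIntegral.integral_const_mul, integral_exp_I_int_mul, sub_eq_zero]
  have hpi : (Real.pi : ℂ) ≠ 0 := by exact_mod_cast Real.pi_ne_zero
  simp only [mul_ite, mul_zero, Finset.sum_ite_eq']
  split_ifs
  · field_simp
  · rfl

theorem fhat_mul_exp (g : ℝ → ℂ) (N k : ℤ) :
    fhat (fun x => g x * Complex.exp (-(Complex.I * (N : ℂ) * (x : ℂ)))) k = fhat g (N + k) := by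
  simp only [fhat_eq_integral]
  congr 1
  refine intervalIntegral.integral_congr fun x _ => ?_
  rw [mul_assoc, ← Complex.exp_add]
  congr 2
  push_cast
  ring

theorem normL_nonneg (g : ℝ → ℂ) : 0 ≤ normL g :=
  intervalIntegral.integral_nonneg (by linarith [Real.pi_pos]) fun _ _ => norm_nonneg _

theorem normL_mul_exp (g : ℝ → ℂ) (N : ℤ) :
    normL (fun x => g x * Complex.exp (-(Complex.I * (N : ℂ) * (x : ℂ)))) = normL g := by
  unfold normL
  refine intervalIntegral.integral_congr fun x _ => ?_
  simp only [norm_mul]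
  rw [show -(Complex.I * (N : ℂ) * (x : ℂ)) = ((-(N * x) : ℝ) : ℂ) * Complex.I by
    push_cast; ring, Complex.norm_exp_ofReal_mul_I, mul_one]

theorem normL_add_le {f g : ℝ → ℂ}
    (hf : IntervalIntegrable f MeasureTheory.volume (-Real.pi) Real.pi)
    (hg : IntervalIntegrable g MeasureTheory.volume (-Real.pi) Real.pi) :
    normL (fun x => f x + g x) ≤ normL f + normL g := by
  unfold normL
  rw [← intervalIntegral.integral_add hf.norm hg.norm]
  exact intervalIntegral.integral_mono_on (by linarith [Real.pi_pos]) (hf.add hg).norm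
    (hf.norm.add hg.norm) fun x _ => norm_add_le _ _

theorem normL_sub_le {f g : ℝ → ℂ}
    (hf : IntervalIntegrable f MeasureTheory.volume (-Real.pi) Real.pi)
    (hg : IntervalIntegrable g MeasureTheory.volume (-Real.pi) Real.pi) :
    normL (fun x => f x - g x) ≤ normL f + normL g := by
  unfold normL
  rw [← intervalIntegral.integral_add hf.norm hg.norm]
  exact intervalIntegral.integral_mono_on (by linarith [Real.pi_pos]) (hf.sub hg).norm
    (hf.norm.add hg.norm) fun x _ => norm_sub_le _ _

theorem normL_const_mul (a : ℂ) (g : ℝ → ℂ) : normL (fun x => a * g x) = ‖a‖ * normL g := by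
  simp only [normL, norm_mul, intervalIntegral.integral_const_mul]

theorem fhat_comp_neg (f : ℝ → ℂ) (n : ℤ) : fhat (fun x => f (-x)) n = fhat f (-n) := by
  simp only [fhat_eq_integral]
  congr 1
  have h := intervalIntegral.integral_comp_neg (a := -Real.pi) (b := Real.pi)
    (fun x : ℝ => f x * Complex.exp (-(Complex.I * ((-n : ℤ) : ℂ) * (x : ℂ))))
  rw [neg_neg] at h
  rw [← h]
  refine intervalIntegral.integral_congr fun x _ => ?_
  simp

theorem normL_comp_neg (f : ℝ → ℂ) : normL (fun x => f (-x)) = normL f := by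
  unfold normL
  rw [intervalIntegral.integral_comp_neg (fun x => ‖f x‖), neg_neg]

theorem partialSum_comp_neg (f : ℝ → ℂ) (n : ℕ) (x : ℝ) :
    partialSum (fun x => f (-x)) n x = partialSum f n (-x) := by
  simp only [partialSum, trigPoly, fhat_comp_neg]
  rw [sum_Icc_neg_natCast, sum_Icc_neg_natCast]
  congr 1
  · simp
  · refine Finset.sum_congr rfl fun k _ => ?_
    rw [add_comm, neg_neg]
    push_cast
    congr 3 <;> ring_nf

/-! ### Fejér means -/

/-- The coefficients of the Fejér kernel of order `M`. -/
noncomputable def fejerCoeff (M : ℕ) (k : ℤ) : ℂ :=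
  ((1 - |(k : ℝ)| / M : ℝ) : ℂ)

/-- Induction on M: passing to M + 1 adds the Dirichlet kernel ∑_{|k|≤M} e^{ikx} to either side. The
factor M is kept so that no division occurs. -/
theorem fejer_kernel_eq_normSq (M : ℕ) (x : ℝ) :
    ∑ k ∈ Finset.Icc (-(M : ℤ)) (M : ℤ),
        (((M : ℝ) - |(k : ℝ)| : ℝ) : ℂ) * Complex.exp (Complex.I * (k : ℂ) * (x : ℂ)) =
      (∑ j ∈ Finset.range M, Complex.exp (Complex.I * (j : ℂ) * (x : ℂ))) *
      (∑ j ∈ Finset.range M, Complex.exp (-(Complex.I * (j : ℂ) * (x : ℂ)))) := by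
  induction M with
  | zero => simp
  | succ M ih =>
    set A := ∑ j ∈ Finset.range M, Complex.exp (Complex.I * (j : ℂ) * (x : ℂ)) with hA
    set B := ∑ j ∈ Finset.range M, Complex.exp (-(Complex.I * (j : ℂ) * (x : ℂ))) with hB
    have h1 : ∑ k ∈ Finset.Icc (-((M + 1 : ℕ) : ℤ)) ((M + 1 : ℕ) : ℤ),
        ((((M + 1 : ℕ) : ℝ) - |(k : ℝ)| : ℝ) : ℂ) *
          Complex.exp (Complex.I * (k : ℂ) * (x : ℂ)) =
        ∑ k ∈ Finset.Icc (-(M : ℤ)) (M : ℤ),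
          (((M : ℝ) - |(k : ℝ)| : ℝ) : ℂ) * Complex.exp (Complex.I * (k : ℂ) * (x : ℂ)) +
        ∑ k ∈ Finset.Icc (-(M : ℤ)) (M : ℤ), Complex.exp (Complex.I * (k : ℂ) * (x : ℂ)) := by
      rw [← Finset.sum_add_distrib, sum_Icc_neg_natCast, Finset.sum_range_succ, ← add_assoc,
        ← sum_Icc_neg_natCast
          (fun k : ℤ => ((((M + 1 : ℕ) : ℝ) - |(k : ℝ)| : ℝ) : ℂ) *
            Complex.exp (Complex.I * (k : ℂ) * (x : ℂ)))]
      have hM : |(M : ℝ) + 1| = M + 1 := abs_of_nonneg (by positivity)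
      have hM' : |-1 + -(M : ℝ)| = M + 1 := by
        rw [← hM, ← abs_neg]; congr 1; ring
      simp only [Int.cast_neg, Int.cast_add, Int.cast_natCast, Int.cast_one, abs_neg, hM]
      push_cast
      simp only [sub_self, zero_mul, add_zero]
      refine Finset.sum_congr rfl fun k _ => ?_
      ring
    have h2 : ∑ k ∈ Finset.Icc (-(M : ℤ)) (M : ℤ),
        Complex.exp (Complex.I * (k : ℂ) * (x : ℂ)) =
        Complex.exp (Complex.I * (M : ℂ) * (x : ℂ)) * B +
          A * Complex.exp (-(Complex.I * (M : ℂ) * (x : ℂ))) + 1 := by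
      rw [sum_Icc_neg_natCast, Finset.sum_add_distrib, hA, hB, Finset.mul_sum, Finset.sum_mul,
        ← Finset.sum_range_reflect, ← Finset.sum_range_reflect (fun k : ℕ =>
          Complex.exp (Complex.I * ((-((k : ℤ) + 1) : ℤ) : ℂ) * (x : ℂ)))]
      simp only [← Complex.exp_add]
      rw [add_comm]
      congr 1
      · congr 1
        · refine Finset.sum_congr rfl fun k hk => ?_
          have hk' : ((M - 1 - k : ℕ) : ℤ) = M - 1 - k := by
            have := Finset.mem_range.1 hk
            omega
          rw [hk']
          push_cast
          congr 1
          ring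
        · refine Finset.sum_congr rfl fun k hk => ?_
          have hk' : ((M - 1 - k : ℕ) : ℤ) = M - 1 - k := by
            have := Finset.mem_range.1 hk
            omega
          rw [hk']
          push_cast
          congr 1
          ring
      · simp
    have h3 : Complex.exp (Complex.I * (M : ℂ) * (x : ℂ)) *
        Complex.exp (-(Complex.I * (M : ℂ) * (x : ℂ))) = 1 := by
      rw [← Complex.exp_add, add_neg_cancel, Complex.exp_zero]
    rw [h1, ih, h2, Finset.sum_range_succ, Finset.sum_range_succ, ← hA, ← hB]
    linear_combination (-1 : ℂ) * h3

/-- Positivity of the kernel, in the form that lets its L¹ norm be read off from its zeroth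
coefficient. -/
theorem trigPoly_fejerCoeff_eq_norm {M : ℕ} (hM : 1 ≤ M) (x : ℝ) :
    trigPoly M (fejerCoeff M) x = (‖trigPoly M (fejerCoeff M) x‖ : ℂ) := by
  have hM0 : (M : ℂ) ≠ 0 := by exact_mod_cast (by omega : M ≠ 0)
  have h : trigPoly M (fejerCoeff M) x =
      (((1 / M : ℝ) * Complex.normSq
        (∑ j ∈ Finset.range M, Complex.exp (Complex.I * (j : ℂ) * (x : ℂ))) : ℝ) : ℂ) := by
    rw [Complex.ofReal_mul, Complex.normSq_eq_conj_mul_self, mul_comm ((starRingEnd ℂ) _), map_sum]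
    have hc : ∀ j : ℕ, (starRingEnd ℂ) (Complex.exp (Complex.I * (j : ℂ) * (x : ℂ))) =
        Complex.exp (-(Complex.I * (j : ℂ) * (x : ℂ))) := by
      intro j
      rw [← Complex.exp_conj]
      congr 1
      simp
    simp only [hc]
    rw [← fejer_kernel_eq_normSq, Finset.mul_sum, trigPoly]
    refine Finset.sum_congr rfl fun k _ => ?_
    rw [fejerCoeff]
    push_cast
    field_simp
  rw [h, Complex.norm_real, Real.norm_of_nonneg]
  exact mul_nonneg (by positivity) (Complex.normSq_nonneg _)

theorem normL_fejer_kernel {M : ℕ} (hM : 1 ≤ M) :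
    normL (trigPoly M (fejerCoeff M)) = 2 * Real.pi := by
  have h0 := fhat_trigPoly M (fejerCoeff M) 0
  rw [fhat_eq_integral] at h0
  have hpi : (Real.pi : ℂ) ≠ 0 := by exact_mod_cast Real.pi_ne_zero
  have h1 : ∫ x in (-Real.pi)..Real.pi, trigPoly M (fejerCoeff M) x = (2 * Real.pi : ℂ) := by
    simp [fejerCoeff] at h0
    field_simp at h0
    simpa [mul_comm] using h0
  rw [intervalIntegral.integral_congr (g := fun x => (‖trigPoly M (fejerCoeff M) x‖ : ℂ))
    (fun x _ => trigPoly_fejerCoeff_eq_norm hM x), intervalIntegral.integral_ofReal] at h1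
  exact_mod_cast h1

theorem trigPoly_mul_fhat_eq_integral {g : ℝ → ℂ}
    (hg : IntervalIntegrable g MeasureTheory.volume (-Real.pi) Real.pi)
    (M : ℕ) (a : ℤ → ℂ) (x : ℝ) :
    trigPoly M (fun k => a k * fhat g k) x =
      (1 / (2 * (Real.pi : ℂ))) * ∫ t in (-Real.pi)..Real.pi, g t * trigPoly M a (x - t) := by
  have h : ∀ t : ℝ, g t * trigPoly M a (x - t) = ∑ k ∈ Finset.Icc (-(M : ℤ)) (M : ℤ),
      a k * Complex.exp (Complex.I * (k : ℂ) * (x : ℂ)) *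
        (g t * Complex.exp (-(Complex.I * (k : ℂ) * (t : ℂ)))) := by
    intro t
    rw [trigPoly, Finset.mul_sum]
    refine Finset.sum_congr rfl fun k _ => ?_
    have : Complex.exp (Complex.I * (k : ℂ) * ((x - t : ℝ) : ℂ)) =
        Complex.exp (Complex.I * (k : ℂ) * (x : ℂ)) *
          Complex.exp (-(Complex.I * (k : ℂ) * (t : ℂ))) := by
      rw [← Complex.exp_add]
      congr 1
      push_cast
      ring
    rw [this]
    ring
  simp only [h]
  rw [intervalIntegral.integral_finsetSum, trigPoly, Finset.mul_sum]
  · refine Finset.sum_congr rfl fun k _ => ?_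
    rw [intervalIntegral.integral_const_mul, fhat_eq_integral]
    ring
  · intro k _
    refine IntervalIntegrable.const_mul ?_ _
    simpa only [neg_mul] using intervalIntegrable_mul_exp hg (-(Complex.I * k))

/-- Young's inequality for convolution with a kernel: Fubini, then translation invariance of the
integral over a period. -/
theorem normL_trigPoly_mul_fhat_le {g : ℝ → ℂ}
    (hg : IntervalIntegrable g MeasureTheory.volume (-Real.pi) Real.pi)
    (M : ℕ) (a : ℤ → ℂ) :
    normL (trigPoly M (fun k => a k * fhat g k)) ≤
      1 / (2 * Real.pi) * (normL g * normL (trigPoly M a)) := by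
  have hpi := Real.pi_pos
  have hle : -Real.pi ≤ Real.pi := by linarith
  set K := trigPoly M a with hK
  have hKc : Continuous K := continuous_trigPoly M a
  have hKp : Function.Periodic (fun x => ‖K x‖) (2 * Real.pi) := fun x => by
    simp only [hK, periodic_trigPoly M a x]
  have hshift : ∀ t : ℝ, ∫ x in (-Real.pi)..Real.pi, ‖K (x - t)‖ = normL K := by
    intro t
    rw [intervalIntegral.integral_comp_sub_right (fun x => ‖K x‖)]
    have := hKp.intervalIntegral_add_eq (-Real.pi - t) (-Real.pi)
    rw [show -Real.pi - t + 2 * Real.pi = Real.pi - t by ring,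
      show -Real.pi + 2 * Real.pi = Real.pi by ring] at this
    exact this
  obtain ⟨B, hB⟩ : ∃ B, ∀ x, ‖K x‖ ≤ B :=
    ⟨∑ k ∈ Finset.Icc (-(M : ℤ)) (M : ℤ), ‖a k‖, fun x => by
      refine (norm_sum_le _ _).trans (Finset.sum_le_sum fun k _ => ?_)
      rw [norm_mul, show Complex.I * (k : ℂ) * (x : ℂ) = ((k * x : ℝ) : ℂ) * Complex.I by
        push_cast; ring, Complex.norm_exp_ofReal_mul_I, mul_one]⟩
  set μ := MeasureTheory.volume.restrict (Set.Ioc (-Real.pi) Real.pi) with hμ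
  have hgi : MeasureTheory.Integrable g μ :=
    (intervalIntegrable_iff_integrableOn_Ioc_of_le hle).1 hg
  have hint : MeasureTheory.Integrable
      (fun p : ℝ × ℝ => ‖g p.2‖ * ‖K (p.1 - p.2)‖) (μ.prod μ) := by
    have h1 : MeasureTheory.Integrable (fun p : ℝ × ℝ => ‖g p.2‖) (μ.prod μ) :=
      (hgi.comp_snd μ).norm
    refine h1.mul_bdd (c := B) (Continuous.aestronglyMeasurable (by fun_prop)) ?_
    exact Filter.Eventually.of_forall fun p => by simpa using hB _
  have hpt : ∀ x, ‖trigPoly M (fun k => a k * fhat g k) x‖ ≤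
      1 / (2 * Real.pi) * ∫ t, ‖g t‖ * ‖K (x - t)‖ ∂μ := by
    intro x
    rw [trigPoly_mul_fhat_eq_integral hg, norm_mul]
    refine mul_le_mul (by simp [abs_of_pos hpi]) ?_ (norm_nonneg _) (by positivity)
    rw [intervalIntegral.integral_of_le hle]
    refine (MeasureTheory.norm_integral_le_integral_norm _).trans_eq ?_
    simp only [norm_mul]
    rfl
  unfold normL
  rw [intervalIntegral.integral_of_le hle]
  calc ∫ x, ‖trigPoly M (fun k => a k * fhat g k) x‖ ∂μ
      ≤ ∫ x, 1 / (2 * Real.pi) * ∫ t, ‖g t‖ * ‖K (x - t)‖ ∂μ ∂μ := by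
        refine MeasureTheory.integral_mono ?_ ?_ hpt
        · exact (intervalIntegrable_iff_integrableOn_Ioc_of_le hle).1
            ((continuous_trigPoly _ _).norm.intervalIntegrable _ _)
        · exact hint.integral_prod_left.const_mul _
    _ = 1 / (2 * Real.pi) * ∫ t, ∫ x, ‖g t‖ * ‖K (x - t)‖ ∂μ ∂μ := by
        rw [MeasureTheory.integral_const_mul, MeasureTheory.integral_integral_swap hint]
    _ = _ := by
        simp only [MeasureTheory.integral_const_mul]
        have : ∀ t, ∫ x, ‖K (x - t)‖ ∂μ = normL K := fun t => by
          rw [← hshift t, intervalIntegral.integral_of_le hle]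
        simp only [this]
        rw [MeasureTheory.integral_mul_const, intervalIntegral.integral_of_le hle]
        rfl

/-- The Fejér means are contractions of `L`. -/
theorem normL_fejer_le {g : ℝ → ℂ}
    (hg : IntervalIntegrable g MeasureTheory.volume (-Real.pi) Real.pi)
    {M : ℕ} (hM : 1 ≤ M) :
    normL (trigPoly M (fun k => fejerCoeff M k * fhat g k)) ≤ normL g := by
  refine (normL_trigPoly_mul_fhat_le hg M _).trans_eq ?_
  rw [normL_fejer_kernel hM]
  field_simp

/-! ### Abel summation and L¹ bounds for exponential sums -/

theorem sub_one_mul_sum_mul_pow (b : ℕ → ℂ) (z : ℂ) (n : ℕ) :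
    (z - 1) * ∑ k ∈ Finset.range (n + 1), b k * z ^ k =
      b n * z ^ (n + 1) - b 0 - ∑ k ∈ Finset.range n, (b (k + 1) - b k) * z ^ (k + 1) := by
  induction n with
  | zero => simp; ring
  | succ n ih =>
    rw [Finset.sum_range_succ, mul_add, ih, Finset.sum_range_succ]
    ring

theorem norm_sub_one_mul_norm_sum_le (b : ℕ → ℂ) {z : ℂ} (hz : ‖z‖ = 1) (n : ℕ) :
    ‖z - 1‖ * ‖∑ k ∈ Finset.range (n + 1), b k * z ^ k‖ ≤
      ‖b n‖ + ‖b 0‖ + ∑ k ∈ Finset.range n, ‖b (k + 1) - b k‖ := by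
  rw [← norm_mul, sub_one_mul_sum_mul_pow]
  refine (norm_sub_le _ _).trans (add_le_add ((norm_sub_le _ _).trans ?_)
    ((norm_sum_le _ _).trans ?_))
  · simp [hz]
  · simp [hz]

theorem abs_le_pi_div_two_mul_norm_exp_sub_one {x : ℝ} (hx : |x| ≤ Real.pi) :
    |x| ≤ Real.pi / 2 * ‖Complex.exp (Complex.I * (x : ℂ)) - 1‖ := by
  have hpi := Real.pi_pos
  rw [Complex.norm_exp_I_mul_ofReal_sub_one, Real.norm_eq_abs, abs_mul, abs_two]
  have h1 : |Real.sin (x / 2)| = Real.sin (|x| / 2) := by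
    rcases abs_cases x with ⟨h, h'⟩ | ⟨h, h'⟩
    · rw [h, abs_of_nonneg (Real.sin_nonneg_of_nonneg_of_le_pi (by linarith) (by linarith))]
    · rw [h, show -x / 2 = -(x / 2) by ring, Real.sin_neg, abs_of_nonpos]
      exact Real.sin_nonpos_of_nonpos_of_neg_pi_le (by linarith) (by linarith)
  have h2 := Real.mul_le_sin (x := |x| / 2) (by positivity) (by linarith)
  rw [h1]
  calc |x| = Real.pi / 2 * (2 * (2 / Real.pi * (|x| / 2))) := by field_simp
    _ ≤ _ := by gcongr

theorem integral_inv_add_abs {n : ℝ} (hn : 0 < n) :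
    ∫ x in (-Real.pi)..Real.pi, (1 / n + |x|)⁻¹ = 2 * Real.log (1 + Real.pi * n) := by
  have hpi := Real.pi_pos
  have hne : ∀ x : ℝ, 1 / n + |x| ≠ 0 := fun x => by positivity
  have hc : Continuous (fun x : ℝ => (1 / n + |x|)⁻¹) :=
    Continuous.inv₀ (by fun_prop) hne
  have h1 : ∫ x in (0 : ℝ)..Real.pi, (1 / n + |x|)⁻¹ = Real.log (1 + Real.pi * n) := by
    have : ∫ x in (0 : ℝ)..Real.pi, (1 / n + |x|)⁻¹ = ∫ x in (0 : ℝ)..Real.pi, (1 / n + x)⁻¹ := by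
      refine intervalIntegral.integral_congr fun x hx => ?_
      rw [Set.uIcc_of_le hpi.le] at hx
      simp only [abs_of_nonneg hx.1]
    rw [this, intervalIntegral.integral_comp_add_left (fun x => x⁻¹),
      integral_inv_of_pos (by positivity) (by positivity)]
    congr 1
    field_simp
    simp
  have h2 : ∫ x in (-Real.pi)..(0 : ℝ), (1 / n + |x|)⁻¹ = Real.log (1 + Real.pi * n) := by
    have := intervalIntegral.integral_comp_neg (a := 0) (b := Real.pi)
      (fun x : ℝ => (1 / n + |x|)⁻¹)
    simp only [abs_neg, neg_zero] at this
    rw [← this, h1]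
  rw [← intervalIntegral.integral_add_adjacent_intervals
    (hc.intervalIntegrable (-Real.pi) 0) (hc.intervalIntegrable 0 Real.pi), h1, h2]
  ring

/-- The weight 1/n + |x| merges the two usual bounds, O(n) near the origin and O(1/|x|) away from
it; its reciprocal integrates to a logarithm. -/
theorem normL_le_of_mul_le {F : ℝ → ℂ} (hF : Continuous F) {n B : ℝ} (hn : 0 < n)
    (h : ∀ x, |x| ≤ Real.pi → (1 / n + |x|) * ‖F x‖ ≤ B) :
    normL F ≤ 2 * B * Real.log (1 + Real.pi * n) := by
  have hpi := Real.pi_pos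
  have hne : ∀ x : ℝ, 0 < 1 / n + |x| := fun x => by positivity
  have hc : Continuous (fun x : ℝ => B * (1 / n + |x|)⁻¹) :=
    continuous_const.mul (Continuous.inv₀ (by fun_prop) fun x => (hne x).ne')
  calc normL F ≤ ∫ x in (-Real.pi)..Real.pi, B * (1 / n + |x|)⁻¹ := by
        refine intervalIntegral.integral_mono_on (by linarith)
          (hF.norm.intervalIntegrable _ _) (hc.intervalIntegrable _ _) fun x hx => ?_
        rw [← div_eq_mul_inv, le_div_iff₀ (hne x), mul_comm]
        exact h x (abs_le.2 hx)
    _ = _ := by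
        rw [intervalIntegral.integral_const_mul, integral_inv_add_abs hn]
        ring

/-- `L¹` bound for an exponential sum in terms of the size and the variation of its
coefficients. -/
theorem normL_sum_mul_exp_le (b : ℕ → ℂ) (m : ℕ) (N : ℤ) {B A : ℝ}
    (hB : ∀ k ∈ Finset.range (m + 1), ‖b k‖ ≤ B)
    (hA : ‖b m‖ + ‖b 0‖ + ∑ k ∈ Finset.range m, ‖b (k + 1) - b k‖ ≤ A) :
    normL (fun x => ∑ k ∈ Finset.range (m + 1),
      b k * Complex.exp (Complex.I * ((N + k : ℤ) : ℂ) * (x : ℂ))) ≤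
      2 * (B + Real.pi / 2 * A) * Real.log (1 + Real.pi * ((m + 1 : ℕ) : ℝ)) := by
  have hpi := Real.pi_pos
  refine normL_le_of_mul_le (by fun_prop) (by positivity) fun x hx => ?_
  set z := Complex.exp (Complex.I * (x : ℂ)) with hz
  have hz1 : ‖z‖ = 1 := by rw [hz, mul_comm, Complex.norm_exp_ofReal_mul_I]
  have hsum : ‖∑ k ∈ Finset.range (m + 1),
      b k * Complex.exp (Complex.I * ((N + k : ℤ) : ℂ) * (x : ℂ))‖ =
      ‖∑ k ∈ Finset.range (m + 1), b k * z ^ k‖ := by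
    have : ∑ k ∈ Finset.range (m + 1),
        b k * Complex.exp (Complex.I * ((N + k : ℤ) : ℂ) * (x : ℂ)) =
        Complex.exp (((N * x : ℝ) : ℂ) * Complex.I) *
          ∑ k ∈ Finset.range (m + 1), b k * z ^ k := by
      rw [Finset.mul_sum]
      refine Finset.sum_congr rfl fun k _ => ?_
      rw [hz, ← Complex.exp_nat_mul, mul_left_comm, ← Complex.exp_add]
      congr 2
      push_cast
      ring
    rw [this, norm_mul, Complex.norm_exp_ofReal_mul_I, one_mul]
  rw [hsum, add_mul]
  -- The part 1/(m+1) is paid by the trivial bound (m+1)B, the part |x| by Abel summation, as |x| ≤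
  -- (π/2)|z - 1|.
  refine add_le_add ?_ ?_
  · rw [one_div, inv_mul_le_iff₀ (by positivity)]
    calc _ ≤ ∑ k ∈ Finset.range (m + 1), ‖b k * z ^ k‖ := norm_sum_le _ _
      _ ≤ ∑ k ∈ Finset.range (m + 1), B :=
        Finset.sum_le_sum fun k hk => by simpa [hz1] using hB k hk
      _ = _ := by simp
  · calc |x| * ‖∑ k ∈ Finset.range (m + 1), b k * z ^ k‖
        ≤ Real.pi / 2 * ‖z - 1‖ * ‖∑ k ∈ Finset.range (m + 1), b k * z ^ k‖ := by
          gcongr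
          exact abs_le_pi_div_two_mul_norm_exp_sub_one hx
      _ ≤ Real.pi / 2 * A := by
          rw [mul_assoc]
          gcongr
          exact (norm_sub_one_mul_norm_sum_le b hz1 m).trans hA

/-! ### De la Vallée Poussin means -/

/-- The de la Vallée Poussin mean of `f`, with spectrum in `[-2n, 2n]`. -/
noncomputable def valleePoussin (f : ℝ → ℂ) (n : ℕ) (x : ℝ) : ℂ :=
  2 * trigPoly (2 * n) (fun k => fejerCoeff (2 * n) k * fhat f k) x -
    trigPoly n (fun k => fejerCoeff n k * fhat f k) x

theorem continuous_valleePoussin (f : ℝ → ℂ) (n : ℕ) : Continuous (valleePoussin f n) := by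
  have h1 := continuous_trigPoly (2 * n) (fun k => fejerCoeff (2 * n) k * fhat f k)
  have h2 := continuous_trigPoly n (fun k => fejerCoeff n k * fhat f k)
  unfold valleePoussin
  fun_prop

theorem normL_valleePoussin_le {g : ℝ → ℂ}
    (hg : IntervalIntegrable g MeasureTheory.volume (-Real.pi) Real.pi)
    {n : ℕ} (hn : 1 ≤ n) : normL (valleePoussin g n) ≤ 3 * normL g := by
  have h1 := normL_fejer_le hg (M := 2 * n) (by omega)
  have h2 := normL_fejer_le hg hn
  have h3 := normL_sub_le
    (f := fun x => 2 * trigPoly (2 * n) (fun k => fejerCoeff (2 * n) k * fhat g k) x)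
    (g := trigPoly n (fun k => fejerCoeff n k * fhat g k))
    (((continuous_trigPoly _ _).const_mul 2).intervalIntegrable _ _)
    ((continuous_trigPoly _ _).intervalIntegrable _ _)
  rw [normL_const_mul, Complex.norm_ofNat] at h3
  refine h3.trans ?_
  linarith

/-- The pair of terms of frequencies `±(k+1)` of a trigonometric polynomial. -/
noncomputable def freqPair (c : ℤ → ℂ) (k : ℕ) (x : ℝ) : ℂ :=
  c ((k + 1 : ℕ) : ℤ) * Complex.exp (Complex.I * (((k + 1 : ℕ) : ℤ) : ℂ) * (x : ℂ)) +
    c (-((k + 1 : ℕ) : ℤ)) * Complex.exp (Complex.I * ((-((k + 1 : ℕ) : ℤ) : ℤ) : ℂ) * (x : ℂ))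

theorem trigPoly_eq_freqPair (c : ℤ → ℂ) (n : ℕ) (x : ℝ) :
    trigPoly n c x = c 0 + ∑ k ∈ Finset.range n, freqPair c k x := by
  rw [trigPoly, sum_Icc_neg_natCast]
  simp [freqPair]

theorem freqPair_fejerCoeff_mul (c : ℤ → ℂ) (M k : ℕ) (x : ℝ) :
    freqPair (fun k => fejerCoeff M k * c k) k x =
      (1 - ((k : ℂ) + 1) / M) * freqPair c k x := by
  have h : |(k : ℝ) + 1| = k + 1 := abs_of_nonneg (by positivity)
  have h1 : fejerCoeff M ((k + 1 : ℕ) : ℤ) = 1 - ((k : ℂ) + 1) / M := by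
    simp [fejerCoeff, h]
  have h2 : fejerCoeff M (-((k + 1 : ℕ) : ℤ)) = 1 - ((k : ℂ) + 1) / M := by
    rw [← h1, fejerCoeff, fejerCoeff, Int.cast_neg, abs_neg]
  rw [freqPair, h1, h2, freqPair]
  ring

theorem fejerCoeff_zero (M : ℕ) : fejerCoeff M 0 = 1 := by simp [fejerCoeff]

/-- The multiplier 2(1 - k/2n) - (1 - k/n) equals 1 for k ≤ n; beyond n only the first term survives
and gives 1 - (k - n)/n. -/
theorem valleePoussin_sub_partialSum (f : ℝ → ℂ) {n : ℕ} (hn : 1 ≤ n) (x : ℝ) :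
    valleePoussin f n x - partialSum f n x =
      ∑ j ∈ Finset.range n, (1 - ((j : ℂ) + 1) / n) * freqPair (fhat f) (n + j) x := by
  have hn0 : (n : ℂ) ≠ 0 := by exact_mod_cast (by omega : n ≠ 0)
  rw [valleePoussin, partialSum, trigPoly_eq_freqPair, trigPoly_eq_freqPair,
    trigPoly_eq_freqPair]
  simp only [freqPair_fejerCoeff_mul, fejerCoeff_zero, one_mul]
  rw [two_mul n, Finset.sum_range_add]
  have h1 : 2 * ∑ k ∈ Finset.range n, (1 - ((k : ℂ) + 1) / ((n + n : ℕ) : ℂ)) *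
        freqPair (fhat f) k x =
      ∑ k ∈ Finset.range n, (1 - ((k : ℂ) + 1) / n) * freqPair (fhat f) k x +
        ∑ k ∈ Finset.range n, freqPair (fhat f) k x := by
    rw [Finset.mul_sum, ← Finset.sum_add_distrib]
    refine Finset.sum_congr rfl fun k _ => ?_
    push_cast
    field_simp
    ring
  have h2 : 2 * ∑ j ∈ Finset.range n, (1 - (((n + j : ℕ) : ℂ) + 1) / ((n + n : ℕ) : ℂ)) *
        freqPair (fhat f) (n + j) x =
      ∑ j ∈ Finset.range n, (1 - ((j : ℂ) + 1) / n) * freqPair (fhat f) (n + j) x := by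
    rw [Finset.mul_sum]
    refine Finset.sum_congr rfl fun k _ => ?_
    push_cast
    field_simp
    ring
  linear_combination h1 + h2

theorem valleePoussin_sub {f g : ℝ → ℂ}
    (hf : IntervalIntegrable f MeasureTheory.volume (-Real.pi) Real.pi)
    (hg : IntervalIntegrable g MeasureTheory.volume (-Real.pi) Real.pi) (n : ℕ) (x : ℝ) :
    valleePoussin (fun x => f x - g x) n x = valleePoussin f n x - valleePoussin g n x := by
  simp only [valleePoussin, trigPoly, fhat_sub hf hg, mul_sub, sub_mul, Finset.sum_sub_distrib]
  ring

theorem valleePoussin_trigPoly (c : ℤ → ℂ) {n : ℕ} (hn : 1 ≤ n) :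
    valleePoussin (trigPoly n c) n = trigPoly n c := by
  funext x
  rw [← sub_eq_zero]
  have h1 : partialSum (trigPoly n c) n x = trigPoly n c x := by
    unfold partialSum trigPoly
    refine Finset.sum_congr rfl fun k hk => ?_
    have := fhat_trigPoly n c k
    rw [if_pos hk] at this
    exact congrArg (· * _) this
  rw [← h1, valleePoussin_sub_partialSum _ hn]
  refine Finset.sum_eq_zero fun j _ => ?_
  have hnot : ∀ k : ℤ, (n : ℤ) < |k| → fhat (trigPoly n c) k = 0 := fun k hk => by
    rw [fhat_trigPoly, if_neg]
    rw [Finset.mem_Icc, ← abs_le]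
    omega
  rw [freqPair, hnot, hnot]
  · simp
  · rw [abs_neg, Nat.abs_cast]
    omega
  · rw [Nat.abs_cast]
    omega

/-- For each T of degree n, f - V_n(f) = (f - T) - V_n(f - T), whence 4 = 1 + 3. -/
theorem normL_sub_valleePoussin_le_bestApprox {f : ℝ → ℂ}
    (hf : IntervalIntegrable f MeasureTheory.volume (-Real.pi) Real.pi)
    {n : ℕ} (hn : 1 ≤ n) :
    normL (fun x => f x - valleePoussin f n x) ≤ 4 * bestApprox f n := by
  rw [bestApprox, Real.mul_iInf_of_nonneg (by norm_num)]
  refine le_ciInf fun c => ?_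
  have hT := (continuous_trigPoly n c).intervalIntegrable
    (μ := MeasureTheory.volume) (-Real.pi) Real.pi
  have hd := hf.sub hT
  have h1 : (fun x => f x - valleePoussin f n x) = fun x =>
      (f x - trigPoly n c x) - valleePoussin (fun x => f x - trigPoly n c x) n x := by
    funext x
    rw [valleePoussin_sub hf hT, valleePoussin_trigPoly c hn]
    ring
  rw [h1]
  refine (normL_sub_le hd ((continuous_valleePoussin _ _).intervalIntegrable _ _)).trans ?_
  have := normL_valleePoussin_le hd hn
  linarith

theorem bestApprox_le (f : ℝ → ℂ) (n : ℕ) :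
    bestApprox f n ≤ normL (fun x => f x - partialSum f n x) :=
  ciInf_le ⟨0, by rintro _ ⟨c, rfl⟩; exact normL_nonneg _⟩ (fhat f)

theorem bestApprox_nonneg (f : ℝ → ℂ) (n : ℕ) : 0 ≤ bestApprox f n :=
  Real.iInf_nonneg fun _ => normL_nonneg _

/-- Discrete product rule. Two copies of β come from the end terms, the third from at most n
increments of the weight, each of size 1/n. -/
theorem variation_mul_linear_le (c : ℕ → ℂ) {n : ℕ} {β V : ℝ}
    (hc : ∀ k ∈ Finset.Icc n (2 * n), ‖c k‖ ≤ β)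
    (hV : ∑ k ∈ Finset.Icc n (2 * n), ‖c (k + 1) - c k‖ ≤ V) {m : ℕ} (hm : m + 1 = n)
    (b : ℕ → ℂ) (hb : ∀ j, b j = (1 - ((j : ℂ) + 1) / n) * c (n + 1 + j)) :
    (∀ k ∈ Finset.range (m + 1), ‖b k‖ ≤ β) ∧
      ‖b m‖ + ‖b 0‖ + ∑ k ∈ Finset.range m, ‖b (k + 1) - b k‖ ≤ 3 * β + V := by
  have hn : (0 : ℝ) < n := by exact_mod_cast (by omega : 0 < n)
  have hw : ∀ j ∈ Finset.range (m + 1), ‖(1 - ((j : ℂ) + 1) / n)‖ ≤ 1 := fun j hj => by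
    have hj' : (j : ℝ) + 1 ≤ n := by
      have := Finset.mem_range.1 hj
      exact_mod_cast (by omega : j + 1 ≤ n)
    have : (1 - ((j : ℂ) + 1) / n) = ((1 - ((j : ℝ) + 1) / n : ℝ) : ℂ) := by push_cast; rfl
    rw [this, Complex.norm_real, Real.norm_eq_abs, abs_le]
    have h1 : ((j : ℝ) + 1) / n ≤ 1 := (div_le_one hn).2 hj'
    have h2 : 0 ≤ ((j : ℝ) + 1) / n := by positivity
    constructor <;> linarith
  have hcb : ∀ j ∈ Finset.range (m + 1), ‖c (n + 1 + j)‖ ≤ β := fun j hj => by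
    refine hc _ ?_
    have := Finset.mem_range.1 hj
    rw [Finset.mem_Icc]
    omega
  have hβ : 0 ≤ β := (norm_nonneg _).trans (hcb 0 (by simp))
  have h0 : ∀ k ∈ Finset.range (m + 1), ‖b k‖ ≤ β := fun k hk => by
    rw [hb, norm_mul]
    calc _ ≤ 1 * β := mul_le_mul (hw k hk) (hcb k hk) (norm_nonneg _) zero_le_one
      _ = β := one_mul _
  refine ⟨h0, ?_⟩
  have hd : ∀ k ∈ Finset.range m, ‖b (k + 1) - b k‖ ≤
      ‖c (n + 1 + k + 1) - c (n + 1 + k)‖ + β / n := fun k hk => by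
    have hk' := Finset.mem_range.1 hk
    have e : b (k + 1) - b k = (1 - ((k : ℂ) + 1) / n) * (c (n + 1 + k + 1) - c (n + 1 + k)) -
        (1 / n : ℂ) * c (n + 1 + (k + 1)) := by
      rw [hb, hb, ← add_assoc (n + 1) k 1]
      push_cast
      ring
    rw [e]
    refine (norm_sub_le _ _).trans (add_le_add ?_ ?_)
    · rw [norm_mul]
      exact mul_le_of_le_one_left (norm_nonneg _) (hw k (by simp; omega))
    · rw [norm_mul, norm_div, norm_one, Complex.norm_natCast, one_div, inv_mul_eq_div]
      gcongr
      exact hcb (k + 1) (by simp; omega)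
  have hs : ∑ k ∈ Finset.range m, ‖c (n + 1 + k + 1) - c (n + 1 + k)‖ ≤ V := by
    refine le_trans ?_ hV
    rw [← Finset.sum_image (s := Finset.range m) (g := fun k => n + 1 + k)
      (f := fun k => ‖c (k + 1) - c k‖) (by intro a _ b _ h; simpa using h)]
    refine Finset.sum_le_sum_of_subset_of_nonneg ?_ fun _ _ _ => norm_nonneg _
    intro k hk
    obtain ⟨j, hj, rfl⟩ := Finset.mem_image.1 hk
    have := Finset.mem_range.1 hj
    rw [Finset.mem_Icc]
    omega
  have hs2 : ∑ k ∈ Finset.range m, ‖b (k + 1) - b k‖ ≤ V + β := by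
    refine (Finset.sum_le_sum hd).trans ?_
    rw [Finset.sum_add_distrib, Finset.sum_const, Finset.card_range, nsmul_eq_mul]
    have : (m : ℝ) * (β / n) ≤ β := by
      rw [mul_div_assoc', div_le_iff₀ hn, mul_comm β]
      have : (m : ℝ) ≤ n := by exact_mod_cast (by omega : m ≤ n)
      gcongr
    linarith
  have := h0 m (by simp)
  have := h0 0 (by simp)
  linarith

theorem normL_valleePoussin_sub_partialSum_le (f : ℝ → ℂ) {n : ℕ} (hn : 1 ≤ n) {β V : ℝ}
    (hp : ∀ k ∈ Finset.Icc n (2 * n), ‖fhat f (k : ℤ)‖ ≤ β)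
    (hq : ∀ k ∈ Finset.Icc n (2 * n), ‖fhat f (-(k : ℤ))‖ ≤ β)
    (hVp : ∑ k ∈ Finset.Icc n (2 * n),
      ‖fhat f ((k + 1 : ℕ) : ℤ) - fhat f (k : ℤ)‖ ≤ V)
    (hVq : ∑ k ∈ Finset.Icc n (2 * n),
      ‖fhat f (-((k + 1 : ℕ) : ℤ)) - fhat f (-(k : ℤ))‖ ≤ V) :
    normL (fun x => valleePoussin f n x - partialSum f n x) ≤
      4 * (β + Real.pi / 2 * (3 * β + V)) * Real.log (1 + Real.pi * n) := by
  obtain ⟨m, rfl⟩ : ∃ m, m + 1 = n := ⟨n - 1, by omega⟩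
  set n := m + 1 with hndef
  obtain ⟨p1, p2⟩ := variation_mul_linear_le (fun k => fhat f (k : ℤ)) hp hVp hndef.symm
    (fun j => (1 - ((j : ℂ) + 1) / n) * fhat f ((n + 1 + j : ℕ) : ℤ)) (fun j => rfl)
  obtain ⟨q1, q2⟩ := variation_mul_linear_le (fun k => fhat f (-(k : ℤ))) hq hVq hndef.symm
    (fun j => (1 - ((j : ℂ) + 1) / n) * fhat f (-((n + 1 + j : ℕ) : ℤ))) (fun j => rfl)
  have hP := normL_sum_mul_exp_le _ m ((n : ℤ) + 1) p1 p2
  have hQ := normL_sum_mul_exp_le _ m ((n : ℤ) + 1) q1 q2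
  -- Negative frequencies become positive under x ↦ -x, which preserves the norm.
  rw [← normL_comp_neg] at hQ
  have e : (fun x => valleePoussin f n x - partialSum f n x) = fun x : ℝ =>
      (∑ k ∈ Finset.range (m + 1),
        (1 - ((k : ℂ) + 1) / n) * fhat f ((n + 1 + k : ℕ) : ℤ) *
          Complex.exp (Complex.I * (((n : ℤ) + 1 + k : ℤ) : ℂ) * (x : ℂ))) +
      ∑ k ∈ Finset.range (m + 1),
        (1 - ((k : ℂ) + 1) / n) * fhat f (-((n + 1 + k : ℕ) : ℤ)) *
          Complex.exp (Complex.I * (((n : ℤ) + 1 + k : ℤ) : ℂ) * ((-x : ℝ) : ℂ)) := by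
    funext x
    rw [valleePoussin_sub_partialSum f hn, ← Finset.sum_add_distrib]
    refine Finset.sum_congr rfl fun k _ => ?_
    rw [freqPair, show n + k + 1 = n + 1 + k by ring]
    push_cast
    rw [mul_add, ← mul_assoc, ← mul_assoc]
    congr 3
    ring
  rw [e]
  refine (normL_add_le (Continuous.intervalIntegrable (by fun_prop) _ _)
    (Continuous.intervalIntegrable (by fun_prop) _ _)).trans ?_
  refine (add_le_add hP hQ).trans_eq ?_
  rw [← hndef]
  ring

/-! ### Hardy-type inequality -/

theorem integral_ofReal_mul_exp_I_nat_mul (j : ℕ) :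
    ∫ x in (0 : ℝ)..(2 * Real.pi),
        (x : ℂ) * Complex.exp (Complex.I * ((j + 1 : ℕ) : ℂ) * (x : ℂ)) =
      2 * Real.pi / (Complex.I * ((j + 1 : ℕ) : ℂ)) := by
  set c : ℂ := Complex.I * ((j + 1 : ℕ) : ℂ) with hc
  have hc0 : c ≠ 0 := mul_ne_zero Complex.I_ne_zero (by exact_mod_cast Nat.succ_ne_zero j)
  have hd : ∀ x : ℝ, HasDerivAt
      (fun x : ℝ => ((x : ℂ) / c - 1 / c ^ 2) * Complex.exp (c * (x : ℂ)))
      ((x : ℂ) * Complex.exp (c * (x : ℂ))) x := by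
    intro x
    have h1 : HasDerivAt (fun x : ℝ => (x : ℂ)) 1 x := Complex.ofRealCLM.hasDerivAt
    have h2 := ((h1.div_const c).sub_const (1 / c ^ 2)).mul ((h1.const_mul c).cexp)
    refine h2.congr_deriv ?_
    field_simp
    ring
  rw [intervalIntegral.integral_eq_sub_of_hasDerivAt (fun x _ => hd x)
    (Continuous.intervalIntegrable (by fun_prop) _ _)]
  have he : Complex.exp (c * ((2 * Real.pi : ℝ) : ℂ)) = 1 := by
    rw [Complex.exp_eq_one_iff]
    exact ⟨(j + 1 : ℕ), by rw [hc]; push_cast; ring⟩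
  rw [he]
  simp

/-- Pairing with x on [0, 2π] produces the weights 1/k without alternating signs, and 0 ≤ x ≤ 2π
bounds the pairing by 2π times the norm. -/
theorem norm_sum_div_le_normL (c : ℤ → ℂ) (M : ℕ) (hc : ∀ k ≤ 0, c k = 0) :
    ‖∑ j ∈ Finset.range M, c ((j + 1 : ℕ) : ℤ) / ((j + 1 : ℕ) : ℂ)‖ ≤ normL (trigPoly M c) := by
  have hpi := Real.pi_pos
  set G := trigPoly M c with hG
  have hGc : Continuous G := continuous_trigPoly M c
  have hG' : ∀ x, G x = ∑ j ∈ Finset.range M, c ((j + 1 : ℕ) : ℤ) *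
      Complex.exp (Complex.I * ((j + 1 : ℕ) : ℂ) * (x : ℂ)) := by
    intro x
    rw [hG, trigPoly_eq_freqPair, hc 0 le_rfl, zero_add]
    refine Finset.sum_congr rfl fun j _ => ?_
    rw [freqPair, hc (-((j + 1 : ℕ) : ℤ)) (by omega), zero_mul, add_zero, Int.cast_natCast]
  have h1 : ∫ x in (0 : ℝ)..(2 * Real.pi), (x : ℂ) * G x =
      2 * Real.pi / Complex.I * ∑ j ∈ Finset.range M, c ((j + 1 : ℕ) : ℤ) / ((j + 1 : ℕ) : ℂ) := by
    simp only [hG', Finset.mul_sum, mul_left_comm _ (c _) _]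
    rw [intervalIntegral.integral_finsetSum
      (fun j _ => Continuous.intervalIntegrable (by fun_prop) _ _)]
    refine Finset.sum_congr rfl fun j _ => ?_
    rw [intervalIntegral.integral_const_mul, integral_ofReal_mul_exp_I_nat_mul]
    field_simp
  have h2 : ‖∫ x in (0 : ℝ)..(2 * Real.pi), (x : ℂ) * G x‖ ≤ 2 * Real.pi * normL G := by
    have hper : ∫ x in (0 : ℝ)..(2 * Real.pi), ‖G x‖ = normL G := by
      have hp : Function.Periodic (fun x => ‖G x‖) (2 * Real.pi) := fun x => by
        simp only [hG, periodic_trigPoly M c x]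
      have := hp.intervalIntegral_add_eq 0 (-Real.pi)
      rw [zero_add, show -Real.pi + 2 * Real.pi = Real.pi by ring] at this
      exact this
    rw [← hper, ← intervalIntegral.integral_const_mul]
    refine (intervalIntegral.norm_integral_le_integral_norm (by positivity)).trans ?_
    refine intervalIntegral.integral_mono_on (by positivity)
      (Continuous.intervalIntegrable (by fun_prop) _ _)
      (Continuous.intervalIntegrable (by fun_prop) _ _) fun x hx => ?_
    rw [norm_mul, Complex.norm_real, Real.norm_of_nonneg hx.1]
    gcongr
    exact hx.2
  rw [h1, norm_mul] at h2
  have h3 : ‖(2 * Real.pi / Complex.I : ℂ)‖ = 2 * Real.pi := by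
    simp [abs_of_pos hpi]
  rw [h3] at h2
  exact le_of_mul_le_mul_left h2 (by positivity)

/-- Hardy-type inequality for the remainder of a Fourier series. -/
theorem norm_sum_fhat_div_le {f : ℝ → ℂ}
    (hf : IntervalIntegrable f MeasureTheory.volume (-Real.pi) Real.pi)
    {N M : ℕ} (hM : 1 ≤ M) (hMN : M ≤ 2 * N) :
    ‖∑ j ∈ Finset.range M, fejerCoeff M ((j + 1 : ℕ) : ℤ) *
      fhat f ((N + (j + 1) : ℕ) : ℤ) / ((j + 1 : ℕ) : ℂ)‖ ≤
      normL (fun x => f x - partialSum f N x) := by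
  have hS : IntervalIntegrable (partialSum f N) MeasureTheory.volume (-Real.pi) Real.pi :=
    (continuous_trigPoly _ _).intervalIntegrable _ _
  have hh := hf.sub hS
  have hg : IntervalIntegrable (fun x => (f x - partialSum f N x) *
      Complex.exp (-(Complex.I * ((N : ℤ) : ℂ) * (x : ℂ)))) MeasureTheory.volume
      (-Real.pi) Real.pi := by
    simpa only [neg_mul] using intervalIntegrable_mul_exp hh (-(Complex.I * ((N : ℤ) : ℂ)))
  -- After the shift the removed frequencies are -2N ≤ k ≤ 0, so with M ≤ 2N the Fejér mean sees
  -- only k > 0.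
  have hfh : ∀ k : ℤ, fhat (fun x => (f x - partialSum f N x) *
      Complex.exp (-(Complex.I * ((N : ℤ) : ℂ) * (x : ℂ)))) k =
      if N + k ∈ Finset.Icc (-(N : ℤ)) (N : ℤ) then 0 else fhat f (N + k) := fun k => by
    rw [fhat_mul_exp (fun x => f x - partialSum f N x), fhat_sub hf hS]
    have : fhat (partialSum f N) (N + k) = _ := fhat_trigPoly N (fhat f) (N + k)
    rw [this]
    split_ifs <;> simp
  have h1 := normL_fejer_le hg hM
  rw [normL_mul_exp (fun x => f x - partialSum f N x)] at h1
  refine le_trans ?_ h1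
  have hMM : (M : ℝ) ≠ 0 := by exact_mod_cast (by omega : M ≠ 0)
  set g := fun x => (f x - partialSum f N x) *
      Complex.exp (-(Complex.I * ((N : ℤ) : ℂ) * (x : ℂ))) with hgdef
  -- The cutoff changes nothing on [-M, M], since the Fejér weight vanishes at -M; it makes the
  -- coefficients zero at every k ≤ 0, as required.
  have h2 := norm_sum_div_le_normL (fun k => if k ≤ -(M : ℤ) then 0 else fejerCoeff M k * fhat g k)
    M ?_
  · refine (le_of_eq ?_).trans (h2.trans (le_of_eq ?_))
    · congr 1
      refine Finset.sum_congr rfl fun j _ => ?_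
      rw [if_neg (by omega), hfh, if_neg (by rw [Finset.mem_Icc]; omega)]
      push_cast
      rfl
    · congr 1
      funext x
      refine Finset.sum_congr rfl fun k hk => ?_
      have hk' := Finset.mem_Icc.1 hk
      simp only
      split_ifs with h
      · have : k = -(M : ℤ) := by omega
        rw [this, fejerCoeff]
        simp [hMM]
      · rfl
  · intro k hk
    split_ifs with h
    · rfl
    · rw [hfh, if_pos (by rw [Finset.mem_Icc]; omega), mul_zero]

theorem cos_mul_norm_le_re {z : ℂ} {θ : ℝ} (hθ : θ < Real.pi / 2) (hz : |Complex.arg z| ≤ θ) :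
    Real.cos θ * ‖z‖ ≤ z.re := by
  rw [← Complex.norm_mul_cos_arg, mul_comm]
  gcongr
  rw [← Real.cos_abs z.arg]
  exact Real.cos_le_cos_of_nonneg_of_le_pi (abs_nonneg _) (by linarith [Real.pi_pos]) hz

/-- In the sector, real parts are nonnegative and dominate cos θ times the modulus. The Fejér mean
of order 2M has weights at least 1/2 for j ≤ M, and the remaining terms can be dropped. -/
theorem sum_norm_fhat_div_le {f : ℝ → ℂ}
    (hf : IntervalIntegrable f MeasureTheory.volume (-Real.pi) Real.pi) {θ : ℝ}
    (hθ0 : 0 ≤ θ) (hθ : θ < Real.pi / 2)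
    (harg : ∀ n : ℕ, |Complex.arg (fhat f (n : ℤ))| ≤ θ) {N M : ℕ} (hM : 1 ≤ M) (hMN : M ≤ N) :
    ∑ j ∈ Finset.range M, ‖fhat f ((N + (j + 1) : ℕ) : ℤ)‖ / ((j + 1 : ℕ) : ℝ) ≤
      2 / Real.cos θ * normL (fun x => f x - partialSum f N x) := by
  have hcos : 0 < Real.cos θ := Real.cos_pos_of_mem_Ioo ⟨by linarith [Real.pi_pos], hθ⟩
  have h := norm_sum_fhat_div_le hf (N := N) (M := 2 * M) (by omega) (by omega)
  rw [div_mul_eq_mul_div, le_div_iff₀ hcos, mul_comm, ← div_le_iff₀' two_pos]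
  refine le_trans ?_ h
  refine le_trans ?_ (Complex.re_le_norm _)
  rw [Complex.re_sum]
  have hMM : (0 : ℝ) < M := by exact_mod_cast (by omega : 0 < M)
  have hre : ∀ j : ℕ, (fejerCoeff (2 * M) ((j + 1 : ℕ) : ℤ) *
      fhat f ((N + (j + 1) : ℕ) : ℤ) / ((j + 1 : ℕ) : ℂ)).re =
      (1 - ((j + 1 : ℕ) : ℝ) / (2 * M)) * ((fhat f ((N + (j + 1) : ℕ) : ℤ)).re /
        ((j + 1 : ℕ) : ℝ)) := fun j => by
    rw [Complex.div_natCast_re, fejerCoeff, Complex.re_ofReal_mul, mul_div_assoc, Int.cast_natCast,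
      Nat.abs_cast]
    push_cast
    rfl
  have hpos : ∀ j : ℕ, 0 ≤ (fhat f ((N + (j + 1) : ℕ) : ℤ)).re / ((j + 1 : ℕ) : ℝ) := fun j =>
    div_nonneg (le_trans (by positivity) (cos_mul_norm_le_re hθ (harg _))) (by positivity)
  simp only [hre]
  rw [mul_div_assoc, Finset.sum_div, Finset.mul_sum]
  refine (Finset.sum_le_sum fun j hj => ?_).trans
    (Finset.sum_le_sum_of_subset_of_nonneg (Finset.range_mono (by omega : M ≤ 2 * M))
      fun j hj _ => ?_)
  · have hj' : ((j + 1 : ℕ) : ℝ) ≤ M := by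
      have := Finset.mem_range.1 hj
      exact_mod_cast (by omega : j + 1 ≤ M)
    have h1 : ((j + 1 : ℕ) : ℝ) / (2 * M) ≤ 1 / 2 := by
      rw [div_le_div_iff₀ (by positivity) two_pos]
      linarith
    calc Real.cos θ * (‖fhat f ((N + (j + 1) : ℕ) : ℤ)‖ / ((j + 1 : ℕ) : ℝ) / 2)
        = 1 / 2 * (Real.cos θ * ‖fhat f ((N + (j + 1) : ℕ) : ℤ)‖ / ((j + 1 : ℕ) : ℝ)) := by ring
      _ ≤ 1 / 2 * ((fhat f ((N + (j + 1) : ℕ) : ℤ)).re / ((j + 1 : ℕ) : ℝ)) := by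
          gcongr
          exact cos_mul_norm_le_re hθ (harg _)
      _ ≤ _ := mul_le_mul_of_nonneg_right (by linarith) (hpos j)
  · have hj' : ((j + 1 : ℕ) : ℝ) ≤ 2 * M := by
      have := Finset.mem_range.1 hj
      exact_mod_cast (by omega : j + 1 ≤ 2 * M)
    refine mul_nonneg (sub_nonneg.2 ((div_le_one (by positivity)).2 hj')) (hpos j)

/-- Sum the hypothesis over M ≤ N ≤ Q. Every k in [2M, Q] is reached as N + j for each j ≤ M, so a_k
collects the full harmonic sum, which is at least log M. -/
theorem log_mul_sum_le {a : ℕ → ℝ} (ha : ∀ n, 0 ≤ a n) {M Q : ℕ} {D : ℝ} (hD : 0 ≤ D)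
    (h : ∀ N, M ≤ N → ∑ j ∈ Finset.range M, a (N + (j + 1)) / ((j + 1 : ℕ) : ℝ) ≤ D) :
    Real.log M * ∑ k ∈ Finset.Icc (2 * M) Q, a k ≤ (Q + 1) * D := by
  have hT : 0 ≤ ∑ k ∈ Finset.Icc (2 * M) Q, a k := Finset.sum_nonneg fun k _ => ha k
  have hlog : Real.log M ≤ ∑ j ∈ Finset.range M, (((j + 1 : ℕ) : ℝ))⁻¹ := by
    rcases Nat.eq_zero_or_pos M with rfl | hM
    · simp
    · have h1 := log_add_one_le_harmonic M
      have h2 : Real.log M ≤ Real.log ((M + 1 : ℕ) : ℝ) :=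
        Real.log_le_log (by exact_mod_cast hM) (by push_cast; linarith)
      refine h2.trans (h1.trans_eq ?_)
      simp [harmonic]
  calc Real.log M * ∑ k ∈ Finset.Icc (2 * M) Q, a k
      ≤ (∑ j ∈ Finset.range M, (((j + 1 : ℕ) : ℝ))⁻¹) * ∑ k ∈ Finset.Icc (2 * M) Q, a k := by
        gcongr
    _ = ∑ j ∈ Finset.range M, (∑ k ∈ Finset.Icc (2 * M) Q, a k) * (((j + 1 : ℕ) : ℝ))⁻¹ := by
        rw [mul_comm, Finset.mul_sum]
    _ ≤ ∑ j ∈ Finset.range M, (∑ N ∈ Finset.Icc M Q, a (N + (j + 1))) *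
          (((j + 1 : ℕ) : ℝ))⁻¹ := by
        refine Finset.sum_le_sum fun j hj => ?_
        have hj' := Finset.mem_range.1 hj
        gcongr
        rw [← Finset.sum_image (s := Finset.Icc M Q) (g := fun N => N + (j + 1)) (f := a)
          (by intro a _ b _ h; simpa using h)]
        refine Finset.sum_le_sum_of_subset_of_nonneg ?_ fun _ _ _ => ha _
        intro k hk
        have hk' := Finset.mem_Icc.1 hk
        exact Finset.mem_image.2 ⟨k - (j + 1), Finset.mem_Icc.2 (by omega),
          Nat.sub_add_cancel (by omega)⟩
    _ = ∑ N ∈ Finset.Icc M Q, ∑ j ∈ Finset.range M, a (N + (j + 1)) / ((j + 1 : ℕ) : ℝ) := by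
        simp only [Finset.sum_mul, div_eq_mul_inv]
        rw [Finset.sum_comm]
    _ ≤ ∑ N ∈ Finset.Icc M Q, D := Finset.sum_le_sum fun N hN => h N (Finset.mem_Icc.1 hN).1
    _ ≤ (Q + 1) * D := by
        rw [Finset.sum_const, nsmul_eq_mul, Nat.card_Icc]
        gcongr
        exact_mod_cast Nat.sub_le _ _

/-! ### Change of scale and mean values of MVBV sequences -/

theorem le_inv_pow_mul_of_le_two_pow_mul {ψ : ℕ → ℝ} (hψ : Antitone ψ) {C : ℝ} (hC : 0 < C)
    (hd : ∀ n, C * ψ n ≤ ψ (2 * n)) (p : ℕ) {M n : ℕ} (h : n ≤ 2 ^ p * M) :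
    ψ M ≤ (C⁻¹) ^ p * ψ n := by
  refine le_trans ?_ (mul_le_mul_of_nonneg_left (hψ h) (by positivity))
  clear h
  induction p with
  | zero => simp
  | succ p ih =>
    refine ih.trans ?_
    rw [pow_succ (C⁻¹), mul_assoc]
    gcongr
    rw [le_inv_mul_iff₀ hC, pow_succ', mul_assoc]
    exact hd _

/-- With M the halved floor, n ≤ 4rM for large n; hence 2^p > 4r suffices, and n² ≤ 16r²M² ≤ nM²
once n ≥ 16r². The exponent p depends on r alone, so it may enter the O-constants. -/
theorem exists_pow_eventually_floor_half {r : ℝ} (hr : 2 ≤ r) :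
    ∃ p : ℕ, ∀ k₀ : ℕ, ∀ᶠ n : ℕ in atTop, k₀ ≤ ⌊r⁻¹ * (n : ℝ)⌋₊ / 2 ∧
      n ≤ 2 ^ p * (⌊r⁻¹ * (n : ℝ)⌋₊ / 2) ∧ n ≤ (⌊r⁻¹ * (n : ℝ)⌋₊ / 2) ^ 2 := by
  have hr0 : 0 < r := by linarith
  obtain ⟨p, hp⟩ := pow_unbounded_of_one_lt (4 * r) (one_lt_two : (1 : ℝ) < 2)
  refine ⟨p, fun k₀ => ?_⟩
  filter_upwards [tendsto_natCast_atTop_atTop.eventually_ge_atTop (4 * r),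
    tendsto_natCast_atTop_atTop.eventually_ge_atTop (4 * r * k₀),
    tendsto_natCast_atTop_atTop.eventually_ge_atTop (16 * r ^ 2)] with n h1 h2 h3
  set q := ⌊r⁻¹ * (n : ℝ)⌋₊ with hq
  have hq1 : r⁻¹ * (n : ℝ) < q + 1 := Nat.lt_floor_add_one _
  have hM1 : (q : ℝ) ≤ 2 * ((q / 2 : ℕ) : ℝ) + 1 := by
    exact_mod_cast (by omega : q ≤ 2 * (q / 2) + 1)
  have hn : (n : ℝ) ≤ 4 * r * ((q / 2 : ℕ) : ℝ) := by
    have h4 : 4 ≤ r⁻¹ * (n : ℝ) := by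
      rw [le_inv_mul_iff₀ hr0]
      linarith
    have h5 : r⁻¹ * (n : ℝ) ≤ 4 * ((q / 2 : ℕ) : ℝ) := by linarith
    rw [inv_mul_le_iff₀ hr0] at h5
    linarith
  set M := q / 2
  have hM0 : (0 : ℝ) ≤ M := M.cast_nonneg
  refine ⟨?_, ?_, ?_⟩
  · have : 4 * r * (k₀ : ℝ) ≤ 4 * r * M := h2.trans hn
    exact_mod_cast le_of_mul_le_mul_left this (by positivity)
  · have : (n : ℝ) ≤ 2 ^ p * M := hn.trans (by gcongr)
    exact_mod_cast this
  · have hnn : (n : ℝ) * n ≤ n * (M : ℝ) ^ 2 := by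
      calc (n : ℝ) * n ≤ (4 * r * M) * (4 * r * M) := by gcongr
        _ = 16 * r ^ 2 * (M : ℝ) ^ 2 := by ring
        _ ≤ _ := by gcongr
    have hn0 : (0 : ℝ) < n := lt_of_lt_of_le (by positivity) h1
    exact_mod_cast le_of_mul_le_mul_left hnn hn0

theorem log_le_two_mul_log_of_le_sq {n M : ℕ} (hn : 1 ≤ n) (h : n ≤ M ^ 2) :
    Real.log n ≤ 2 * Real.log M := by
  have : Real.log n ≤ Real.log ((M : ℝ) ^ 2) :=
    Real.log_le_log (by exact_mod_cast hn) (by exact_mod_cast h)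
  simpa using this

theorem norm_sub_le_sum_norm_sub (c : ℕ → ℂ) {n k m : ℕ} (hnk : n ≤ k) (hkm : k ≤ m) :
    ‖c n‖ ≤ ‖c k‖ + ∑ j ∈ Finset.Icc n m, ‖c (j + 1) - c j‖ := by
  have h1 : ‖c k - c n‖ ≤ ∑ j ∈ Finset.Icc n m, ‖c (j + 1) - c j‖ := by
    rw [← Finset.sum_Ico_sub c hnk]
    refine (norm_sum_le _ _).trans (Finset.sum_le_sum_of_subset_of_nonneg ?_
      fun _ _ _ => norm_nonneg _)
    intro j hj
    have := Finset.mem_Ico.1 hj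
    exact Finset.mem_Icc.2 (by omega)
  have h2 := norm_sub_norm_le (c n) (c k)
  rw [norm_sub_rev] at h2
  linarith

theorem Icc_subset_Icc_floor {r : ℝ} (hr : 2 ≤ r) (n : ℕ) :
    Finset.Icc n (2 * n) ⊆ Finset.Icc ⌊r⁻¹ * (n : ℝ)⌋₊ ⌊r * (n : ℝ)⌋₊ := by
  refine Finset.Icc_subset_Icc ?_ ?_
  · refine Nat.floor_le_of_le ?_
    exact mul_le_of_le_one_left n.cast_nonneg (inv_le_one_of_one_le₀ (by linarith))
  · refine Nat.le_floor ?_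
    push_cast
    gcongr

/-- Average |c_n| ≤ |c_k| + V over n ≤ k ≤ 2n, where V is the variation on that block, itself
bounded by the same mean. -/
theorem norm_le_mean_of_mvbv {c : ℕ → ℂ} {r C : ℝ} (hr : 2 ≤ r) {n : ℕ} (hn : 1 ≤ n)
    (h : ∑ k ∈ Finset.Icc n (2 * n), ‖c (k + 1) - c k‖ ≤
      C * (1 / (n : ℝ)) * ∑ k ∈ Finset.Icc ⌊r⁻¹ * (n : ℝ)⌋₊ ⌊r * (n : ℝ)⌋₊, ‖c k‖) :
    ‖c n‖ ≤ (1 + C) / n * ∑ k ∈ Finset.Icc ⌊r⁻¹ * (n : ℝ)⌋₊ ⌊r * (n : ℝ)⌋₊, ‖c k‖ := by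
  have hn0 : (0 : ℝ) < n := by exact_mod_cast hn
  set T := ∑ k ∈ Finset.Icc ⌊r⁻¹ * (n : ℝ)⌋₊ ⌊r * (n : ℝ)⌋₊, ‖c k‖ with hT
  set V := ∑ k ∈ Finset.Icc n (2 * n), ‖c (k + 1) - c k‖ with hV
  have hT0 : 0 ≤ T := Finset.sum_nonneg fun _ _ => norm_nonneg _
  have h1 : ∑ k ∈ Finset.Icc n (2 * n), ‖c k‖ ≤ T :=
    Finset.sum_le_sum_of_subset_of_nonneg (Icc_subset_Icc_floor hr n) fun _ _ _ => norm_nonneg _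
  have h2 : ((n : ℝ) + 1) * (‖c n‖ - V) ≤ T := by
    refine le_trans ?_ h1
    have : ∑ k ∈ Finset.Icc n (2 * n), (‖c n‖ - V) ≤ ∑ k ∈ Finset.Icc n (2 * n), ‖c k‖ :=
      Finset.sum_le_sum fun k hk => by
        have hk' := Finset.mem_Icc.1 hk
        have := norm_sub_le_sum_norm_sub c hk'.1 hk'.2
        linarith
    rw [Finset.sum_const, Nat.card_Icc, nsmul_eq_mul] at this
    rw [show 2 * n + 1 - n = n + 1 by omega] at this
    exact_mod_cast this
  have h3 : ‖c n‖ - V ≤ T / n := by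
    rw [le_div_iff₀ hn0]
    rcases le_total 0 (‖c n‖ - V) with h | h
    · linarith
    · exact (mul_nonpos_of_nonpos_of_nonneg h hn0.le).trans hT0
  calc ‖c n‖ ≤ T / n + C * (1 / (n : ℝ)) * T := by linarith
    _ = _ := by ring

/-! ### The two implications -/

theorem isBigO_log_mul_fhat_of_partialSum {f : ℝ → ℂ}
    (hf : IntervalIntegrable f MeasureTheory.volume (-Real.pi) Real.pi)
    {ψ : ℕ → ℝ} (hψ : Antitone ψ) (hψ0 : ∀ n, 0 ≤ ψ n) {C₁ : ℝ} (hC₁ : 0 < C₁)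
    (hd : ∀ n, C₁ * ψ n ≤ ψ (2 * n)) (hc : IsMVBVS (fun n : ℕ => fhat f (n : ℤ)))
    (h : (fun n : ℕ => normL (fun x => f x - partialSum f n x)) =O[atTop] ψ) :
    (fun n : ℕ => Real.log n * ‖fhat f (n : ℤ)‖) =O[atTop] ψ := by
  obtain ⟨⟨θ, hθ0, hθ, harg⟩, r, hr, C, hC, hV⟩ := hc
  have hcos : 0 < Real.cos θ := Real.cos_pos_of_mem_Ioo ⟨by linarith [Real.pi_pos], hθ⟩
  obtain ⟨D, hD, hD'⟩ := h.exists_pos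
  obtain ⟨N₀, hN₀⟩ := eventually_atTop.1 hD'.bound
  obtain ⟨p, hp⟩ := exists_pow_eventually_floor_half hr
  have hr0 : 0 < r := by linarith
  refine IsBigO.of_bound (2 * (1 + C) * ((r + 1) * (2 / Real.cos θ * D * (C₁⁻¹) ^ p))) ?_
  filter_upwards [hp (max N₀ 1), eventually_ge_atTop 1] with n hn hn1
  set q := ⌊r⁻¹ * (n : ℝ)⌋₊ with hq
  set M := q / 2 with hM
  set Q := ⌊r * (n : ℝ)⌋₊ with hQ
  obtain ⟨hM0, hnM, hnM2⟩ := hn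
  have hM1 : 1 ≤ M := (le_max_right _ _).trans hM0
  have hn0 : (0 : ℝ) < n := by exact_mod_cast hn1
  have hn1' : (1 : ℝ) ≤ n := by exact_mod_cast hn1
  have hψM : ψ M ≤ (C₁⁻¹) ^ p * ψ n := le_inv_pow_mul_of_le_two_pow_mul hψ hC₁ hd p hnM
  have hsum : ∀ N, M ≤ N → ∑ j ∈ Finset.range M,
      ‖fhat f ((N + (j + 1) : ℕ) : ℤ)‖ / ((j + 1 : ℕ) : ℝ) ≤
        2 / Real.cos θ * D * (C₁⁻¹) ^ p * ψ n := fun N hN => by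
    refine (sum_norm_fhat_div_le hf hθ0 hθ harg hM1 hN).trans ?_
    have h1 := hN₀ N ((le_max_left _ _).trans (hM0.trans hN))
    rw [Real.norm_of_nonneg (normL_nonneg _), Real.norm_of_nonneg (hψ0 _)] at h1
    rw [mul_assoc (2 / Real.cos θ), mul_assoc (2 / Real.cos θ), mul_assoc D]
    refine mul_le_mul_of_nonneg_left (h1.trans ?_) (by positivity)
    exact mul_le_mul_of_nonneg_left ((hψ hN).trans hψM) hD.le
  have hψn := hψ0 n
  have h2 := log_mul_sum_le (a := fun n => ‖fhat f (n : ℤ)‖) (fun _ => norm_nonneg _) (Q := Q)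
    (by positivity) hsum
  have hE : 0 ≤ 2 / Real.cos θ * D * (C₁⁻¹) ^ p := by positivity
  generalize 2 / Real.cos θ * D * (C₁⁻¹) ^ p = E at h2 hE ⊢
  set T := ∑ k ∈ Finset.Icc q Q, ‖fhat f (k : ℤ)‖ with hT
  -- Halving q made 2M ≤ q, so the block of the MVBV mean lies inside the block of the logarithmic
  -- estimate.
  have hT2 : T ≤ ∑ k ∈ Finset.Icc (2 * M) Q, ‖fhat f (k : ℤ)‖ :=
    Finset.sum_le_sum_of_subset_of_nonneg (Finset.Icc_subset_Icc_left (by omega))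
      fun _ _ _ => norm_nonneg _
  have hT0 : 0 ≤ T := Finset.sum_nonneg fun _ _ => norm_nonneg _
  have hlogM : 0 ≤ Real.log M := Real.log_natCast_nonneg _
  have hlogn : 0 ≤ Real.log n := Real.log_natCast_nonneg _
  have hQn : (Q : ℝ) + 1 ≤ (r + 1) * n := by
    have : (Q : ℝ) ≤ r * n := Nat.floor_le (by positivity)
    linarith
  have h3 := norm_le_mean_of_mvbv (c := fun n : ℕ => fhat f (n : ℤ)) hr hn1 (hV n hn1)
  rw [Real.norm_of_nonneg (by positivity), Real.norm_of_nonneg hψn]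
  calc Real.log n * ‖fhat f (n : ℤ)‖
      ≤ (2 * Real.log M) * ((1 + C) / n * T) := by
        gcongr
        exact log_le_two_mul_log_of_le_sq hn1 hnM2
    _ = 2 * (1 + C) / n * (Real.log M * T) := by ring
    _ ≤ 2 * (1 + C) / n * ((r + 1) * n * (E * ψ n)) := by
        refine mul_le_mul_of_nonneg_left ?_ (by positivity)
        refine (mul_le_mul_of_nonneg_left hT2 hlogM).trans (h2.trans ?_)
        exact mul_le_mul_of_nonneg_right hQn (by positivity)
    _ = _ := by field_simp

/-- On the whole MVBV block k is comparable with n, so ψ_k ≲ ψ_n and log n ≤ 2 log k. Each term is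
thus O(ψ_n / log n), and so is the mean bounding the variation. -/
theorem exists_eventually_norm_le_of_isBigO_log {c : ℕ → ℂ} {ψ : ℕ → ℝ} (hψ : Antitone ψ)
    (hψ0 : ∀ n, 0 ≤ ψ n) {C₁ : ℝ} (hC₁ : 0 < C₁)
    (hd : ∀ n, C₁ * ψ n ≤ ψ (2 * n)) (hc : IsMVBVS c)
    (h : (fun n : ℕ => Real.log n * ‖c n‖) =O[atTop] ψ) :
    ∃ K, ∀ᶠ n : ℕ in atTop, (∀ k ∈ Finset.Icc n (2 * n), ‖c k‖ ≤ K * (ψ n / Real.log n)) ∧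
      ∑ k ∈ Finset.Icc n (2 * n), ‖c (k + 1) - c k‖ ≤ K * (ψ n / Real.log n) := by
  obtain ⟨-, r, hr, C, hC, hV⟩ := hc
  obtain ⟨D, hD, hD'⟩ := h.exists_pos
  obtain ⟨N₀, hN₀⟩ := eventually_atTop.1 hD'.bound
  obtain ⟨p, hp⟩ := exists_pow_eventually_floor_half hr
  have hr0 : 0 < r := by linarith
  set B := 2 * D * (C₁⁻¹) ^ p with hB
  -- B bounds single terms; the variation costs C/n times at most (r+1)n terms of size B.
  refine ⟨max B (C * (r + 1) * B), ?_⟩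
  filter_upwards [hp (max N₀ 2), eventually_ge_atTop 2] with n hn hn2
  set q := ⌊r⁻¹ * (n : ℝ)⌋₊ with hq
  set M := q / 2 with hM
  set Q := ⌊r * (n : ℝ)⌋₊ with hQ
  obtain ⟨hM0, hnM, hnM2⟩ := hn
  have hM2 : 2 ≤ M := (le_max_right _ _).trans hM0
  have hn1' : (1 : ℝ) < n := by exact_mod_cast hn2
  have hlogn : 0 < Real.log n := Real.log_pos hn1'
  have hψM : ψ M ≤ (C₁⁻¹) ^ p * ψ n := le_inv_pow_mul_of_le_two_pow_mul hψ hC₁ hd p hnM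
  have hψn := hψ0 n
  have hβ : 0 ≤ ψ n / Real.log n := by positivity
  have hck : ∀ k, q ≤ k → ‖c k‖ ≤ B * (ψ n / Real.log n) := fun k hk => by
    have hMk : M ≤ k := (Nat.div_le_self _ _).trans hk
    have h1 := hN₀ k ((le_max_left _ _).trans (hM0.trans hMk))
    rw [Real.norm_of_nonneg (mul_nonneg (Real.log_natCast_nonneg _) (norm_nonneg _)),
      Real.norm_of_nonneg (hψ0 _)] at h1
    have h2 : Real.log n ≤ 2 * Real.log k :=
      log_le_two_mul_log_of_le_sq (by omega) (hnM2.trans (Nat.pow_le_pow_left hMk 2))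
    rw [← mul_div_assoc, le_div_iff₀ hlogn]
    calc ‖c k‖ * Real.log n ≤ ‖c k‖ * (2 * Real.log k) := by gcongr
      _ = 2 * (Real.log k * ‖c k‖) := by ring
      _ ≤ 2 * (D * ((C₁⁻¹) ^ p * ψ n)) := by
          refine mul_le_mul_of_nonneg_left (h1.trans ?_) zero_le_two
          exact mul_le_mul_of_nonneg_left ((hψ hMk).trans hψM) hD.le
      _ = _ := by rw [hB]; ring
  refine ⟨fun k hk => ?_, ?_⟩
  · refine (hck k ?_).trans (mul_le_mul_of_nonneg_right (le_max_left _ _) hβ)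
    exact (Finset.mem_Icc.1 (Icc_subset_Icc_floor hr n hk)).1
  · refine le_trans ?_ (mul_le_mul_of_nonneg_right (le_max_right _ _) hβ)
    refine (hV n (by omega)).trans ?_
    have hQn : ((Q + 1 - q : ℕ) : ℝ) ≤ (r + 1) * n := by
      have h1 : (Q : ℝ) ≤ r * n := Nat.floor_le (by positivity)
      have h2 : ((Q + 1 - q : ℕ) : ℝ) ≤ Q + 1 := by exact_mod_cast Nat.sub_le _ _
      linarith
    have hB0 : 0 ≤ B := by positivity
    calc C * (1 / (n : ℝ)) * ∑ k ∈ Finset.Icc q Q, ‖c k‖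
        ≤ C * (1 / (n : ℝ)) * ∑ k ∈ Finset.Icc q Q, B * (ψ n / Real.log n) := by
          gcongr with k hk
          exact hck k (Finset.mem_Icc.1 hk).1
      _ = C * (1 / (n : ℝ)) * (((Q + 1 - q : ℕ) : ℝ) * (B * (ψ n / Real.log n))) := by
          rw [Finset.sum_const, Nat.card_Icc, nsmul_eq_mul]
      _ ≤ C * (1 / (n : ℝ)) * ((r + 1) * n * (B * (ψ n / Real.log n))) := by gcongr
      _ = _ := by field_simp

theorem log_one_add_pi_mul_le {n : ℕ} (hn : 2 ≤ n) :
    Real.log (1 + Real.pi * n) ≤ 4 * Real.log n := by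
  have hn2 : (2 : ℝ) ≤ n := by exact_mod_cast hn
  have h1 : 1 + Real.pi * n ≤ (n : ℝ) ^ 4 := by
    have h8 : (8 : ℝ) ≤ (n : ℝ) ^ 3 := by
      calc (8 : ℝ) = 2 ^ 3 := by norm_num
        _ ≤ _ := by gcongr
    calc 1 + Real.pi * n ≤ 1 + 4 * n := by
          gcongr
          exact Real.pi_le_four
      _ ≤ 8 * n := by linarith
      _ ≤ (n : ℝ) ^ 3 * n := by gcongr
      _ = _ := by ring
  have := Real.log_le_log (by positivity) h1
  simpa using this

theorem isBigO_partialSum_of_isBigO_log {f : ℝ → ℂ}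
    (hf : IntervalIntegrable f MeasureTheory.volume (-Real.pi) Real.pi)
    {ψ : ℕ → ℝ} (hψ : Antitone ψ) (hψ0 : ∀ n, 0 ≤ ψ n) {C₁ : ℝ} (hC₁ : 0 < C₁)
    (hd : ∀ n, C₁ * ψ n ≤ ψ (2 * n)) (hp : IsMVBVS (fun n : ℕ => fhat f (n : ℤ)))
    (hq : IsMVBVS (fun n : ℕ => fhat f (-(n : ℤ))))
    (hE : (fun n : ℕ => bestApprox f n) =O[atTop] ψ)
    (hlp : (fun n : ℕ => Real.log n * ‖fhat f (n : ℤ)‖) =O[atTop] ψ)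
    (hlq : (fun n : ℕ => Real.log n * ‖fhat f (-(n : ℤ))‖) =O[atTop] ψ) :
    (fun n : ℕ => normL (fun x => f x - partialSum f n x)) =O[atTop] ψ := by
  have hpi := Real.pi_pos
  obtain ⟨K, hK⟩ := exists_eventually_norm_le_of_isBigO_log hψ hψ0 hC₁ hd hp hlp
  obtain ⟨K', hK'⟩ := exists_eventually_norm_le_of_isBigO_log hψ hψ0 hC₁ hd hq hlq
  obtain ⟨D, hD⟩ := hE.bound
  refine IsBigO.of_bound (4 * D + 16 * (1 + 2 * Real.pi) * max K K') ?_
  filter_upwards [hK, hK', hD, eventually_ge_atTop 2] with n ⟨h1, h2⟩ ⟨h3, h4⟩ h5 hn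
  have hlogn : 0 < Real.log n := Real.log_pos (by exact_mod_cast hn)
  have hψn := hψ0 n
  have hβ : 0 ≤ ψ n / Real.log n := by positivity
  rw [Real.norm_of_nonneg (bestApprox_nonneg _ _), Real.norm_of_nonneg hψn] at h5
  rw [Real.norm_of_nonneg (normL_nonneg _), Real.norm_of_nonneg hψn]
  have e1 := mul_le_mul_of_nonneg_right (le_max_left K K') hβ
  have e2 := mul_le_mul_of_nonneg_right (le_max_right K K') hβ
  set β := max K K' * (ψ n / Real.log n) with hβdef
  have hβ0 : 0 ≤ β := (norm_nonneg _).trans ((h1 n (by simp; omega)).trans e1)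
  have hA := normL_valleePoussin_sub_partialSum_le f (n := n) (by omega)
    (fun k hk => (h1 k hk).trans e1) (fun k hk => (h3 k hk).trans e2) (h2.trans e1) (h4.trans e2)
  have hB := normL_sub_valleePoussin_le_bestApprox hf (n := n) (by omega)
  have hVc := continuous_valleePoussin f n
  have hSc : Continuous (partialSum f n) := continuous_trigPoly _ _
  have hsplit : normL (fun x => f x - partialSum f n x) ≤
      normL (fun x => f x - valleePoussin f n x) +
        normL (fun x => valleePoussin f n x - partialSum f n x) := by
    refine le_of_eq_of_le ?_ (normL_add_le (hf.sub (hVc.intervalIntegrable _ _))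
      ((hVc.sub hSc).intervalIntegrable _ _))
    congr 1
    funext x
    simp
  -- The logarithm from the L¹ bound cancels the one in the denominator of β.
  have hlast : 4 * (β + Real.pi / 2 * (3 * β + β)) * Real.log (1 + Real.pi * n) ≤
      16 * (1 + 2 * Real.pi) * max K K' * ψ n := by
    calc _ ≤ 4 * (β + Real.pi / 2 * (3 * β + β)) * (4 * Real.log n) := by
          gcongr
          exact log_one_add_pi_mul_le hn
      _ = 16 * (1 + 2 * Real.pi) * (β * Real.log n) := by ring
      _ = _ := by
          rw [hβdef]
          field_simp
  calc normL (fun x => f x - partialSum f n x)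
      ≤ 4 * (D * ψ n) + 16 * (1 + 2 * Real.pi) * max K K' * ψ n := by
        refine hsplit.trans (add_le_add (hB.trans ?_) (hA.trans hlast))
        gcongr
    _ = _ := by ring

theorem isBigO_cofinite_int_iff {u : ℤ → ℂ} {ψ : ℕ → ℝ} :
    (fun n : ℤ => u n * (Real.log |(n : ℝ)| : ℂ)) =O[cofinite] (fun n : ℤ => ψ n.natAbs) ↔
      (fun n : ℕ => Real.log n * ‖u (n : ℤ)‖) =O[atTop] ψ ∧
        (fun n : ℕ => Real.log n * ‖u (-(n : ℤ))‖) =O[atTop] ψ := by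
  have hneg : (atBot : Filter ℤ) = map (fun n : ℕ => -(n : ℤ)) atTop := by
    have := Filter.map_map (f := (atTop : Filter ℕ)) (m := fun n : ℕ => (n : ℤ))
      (m' := fun n : ℤ => -n)
    rw [Nat.map_cast_int_atTop, Filter.map_neg_atTop] at this
    exact this
  rw [Int.cofinite_eq, isBigO_sup, and_comm, hneg, ← Nat.map_cast_int_atTop, isBigO_map,
    isBigO_map]
  have hn : ∀ (v : ℕ → ℂ), ((fun n : ℕ => v n * (Real.log n : ℂ)) =O[atTop] ψ ↔
      (fun n : ℕ => Real.log n * ‖v n‖) =O[atTop] ψ) := fun v => by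
    rw [← isBigO_norm_left]
    have : ∀ n : ℕ, ‖v n * (Real.log n : ℂ)‖ = Real.log n * ‖v n‖ := fun n => by
      rw [norm_mul, Complex.norm_real, Real.norm_of_nonneg (Real.log_natCast_nonneg _), mul_comm]
    simp only [this]
  rw [← hn, ← hn]
  simp [Function.comp_def]

theorem theorem2 (f : ℝ → ℂ) (hf : MemLTwoPi f)
    (ψ : ℕ → ℝ) (hψ_anti : Antitone ψ) (hψ_lim : Tendsto ψ atTop (nhds 0))
    (hψ_doubling : ∃ C₁ C₂ : ℝ, 0 < C₁ ∧ 0 < C₂ ∧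
      ∀ n : ℕ, C₁ * ψ n ≤ ψ (2 * n) ∧ ψ (2 * n) ≤ C₂ * ψ n)
    (hpos : IsMVBVS (fun n : ℕ => fhat f (n : ℤ)))
    (hneg : IsMVBVS (fun n : ℕ => fhat f (-(n : ℤ)))) :
    (fun n : ℕ => normL (fun x => f x - partialSum f n x)) =O[atTop] ψ ↔
      ((fun n : ℕ => bestApprox f n) =O[atTop] ψ ∧
        (fun n : ℤ => fhat f n * (Real.log |(n : ℝ)| : ℂ))
          =O[cofinite] (fun n : ℤ => ψ n.natAbs)) := by
  obtain ⟨C₁, _, hC₁, _, hd'⟩ := hψ_doubling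
  have hd : ∀ n, C₁ * ψ n ≤ ψ (2 * n) := fun n => (hd' n).1
  have hψ0 : ∀ n, 0 ≤ ψ n := hψ_anti.le_of_tendsto hψ_lim
  rw [isBigO_cofinite_int_iff]
  constructor
  · intro h
    refine ⟨?_, isBigO_log_mul_fhat_of_partialSum hf.2 hψ_anti hψ0 hC₁ hd hpos h, ?_⟩
    · refine IsBigO.trans (IsBigO.of_bound 1 (Eventually.of_forall fun n => ?_)) h
      rw [one_mul, Real.norm_of_nonneg (bestApprox_nonneg _ _),
        Real.norm_of_nonneg (normL_nonneg _)]
      exact bestApprox_le f n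
    -- Negative frequencies: apply the positive case to f(-x), whose partial sums have the same
    -- error norms.
    · have hf' : IntervalIntegrable (fun x => f (-x)) MeasureTheory.volume
          (-Real.pi) Real.pi := by
        simpa using ((IntervalIntegrable.iff_comp_neg (by simp)).1 hf.2).symm
      have hneg' : IsMVBVS (fun n : ℕ => fhat (fun x => f (-x)) (n : ℤ)) := by
        simpa only [fhat_comp_neg] using hneg
      have := isBigO_log_mul_fhat_of_partialSum hf' hψ_anti hψ0 hC₁ hd hneg' ?_
      · simpa only [fhat_comp_neg] using this
      · refine h.congr_left fun n => ?_
        simp only [partialSum_comp_neg]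
        exact (normL_comp_neg (fun x => f x - partialSum f n x)).symm
  · rintro ⟨hE, hlp, hlq⟩
    exact isBigO_partialSum_of_isBigO_log hf.2 hψ_anti hψ0 hC₁ hd hpos hneg hE hlp hlq
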